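/- Let $f:[0,\infty)\to[0,\infty)$ be continuous with $f(0)=0$, and let $K>0$ be a locally unstable equilibrium, $f(K)=K$, with $f(x)>x$ for $x\in(0,K)$ and $0<f(x)<x$ for $x\in(K,\infty)$. Suppose that $f$ is three times differentiable on $(0,\infty)$ and differentiable from the right at $0$ with $f'(0)>1$, that $f$ is unimodal with a unique critical point $c\in(0,K)$ (strictly increasing on $[0,c]$, strictly decreasing on $[c,\infty)$), that $f''(x)<0$ for all $x\in(0,c)$, and that the Schwarzian derivative $$(Sf)(x)=\frac{f'''(x)}{f'(x)}-\frac32\left(\frac{f''(x)}{f'(x)}\right)^2$$ is negative for all $x\in(0,\infty)\setminus\{c\}$. Let $(\xi_n)_{n\ge1}$ be independent identically distributed random variables on a probability space, with $|\xi_n|\le1$ and $\mathbb P\{\xi_n\in(1-\varepsilon,1]\}>0$ for every $\varepsilon>0$; let $\xi$ denote a random variable with their common distribution. Put $$L_0=-f'(K),\qquad \alpha_0=\frac{L_0-1}{L_0+1},$$ and let $\alpha\in(0,\alpha_0)$ and $\ell\in\left(\alpha_0-\alpha,\ \min\{\alpha,1-\alpha\}\right)$. Assume that either $$\alpha+\ell<\frac{L_0}{L_0+1}\quad\text{and}\quad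 \mathbb E\ln\left[(1-\alpha-\ell\xi)L_0-\alpha-\ell\xi\right]<0,$$ or $$\mathbb E\max\left\{\ln\left[(1-\alpha-\ell\xi)L_0\right],\ \ln[\alpha+\ell\xi]\right\}<0.$$ Then for every (nonrandom) $x_0>0$ the solution of $$x_{n+1}=(1-\alpha-\ell\xi_{n+1})f(x_n)+(\alpha+\ell\xi_{n+1})x_n,\qquad n\ge0,$$ satisfies $\lim_{n\to\infty}x_n=K$ almost surely. -/

import Mathlib

open Set Filter Topology MeasureTheory ProbabilityTheory

/-- Lyapunov instability of the equilibrium `K` of the map `f : [0, ∞) → [0, ∞)`. -/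
def LocallyUnstable (f : ℝ → ℝ) (K : ℝ) : Prop :=
  ¬ ∀ ε > 0, ∃ δ > 0, ∀ x ≥ 0, |x - K| < δ → ∀ n : ℕ, |f^[n] x - K| < ε

/-- The basic assumption on the map `f : [0, ∞) → [0, ∞)` with unique positive equilibrium `K`.
Maps on the half-line are written as functions on `ℝ`; only their values on `[0, ∞)` matter. -/
structure PopulationMap (f : ℝ → ℝ) (K : ℝ) : Prop where
  mapsTo : MapsTo f (Ici 0) (Ici 0)
  continuousOn : ContinuousOn f (Ici 0)
  map_zero : f 0 = 0
  pos : 0 < K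
  map_eq : f K = K
  lt_map : ∀ x ∈ Ioo 0 K, x < f x
  map_pos : ∀ x ∈ Ioi K, 0 < f x
  map_lt : ∀ x ∈ Ioi K, f x < x
  unstable : LocallyUnstable f K

/-- The Schwarzian derivative `f''' / f' - (3/2) (f'' / f')²`. -/
noncomputable def schwarzian (f : ℝ → ℝ) (x : ℝ) : ℝ :=
  iteratedDeriv 3 f x / deriv f x - 3 / 2 * (iteratedDeriv 2 f x / deriv f x) ^ 2

/-- Unimodal maps, three times differentiable, with maximum at the unique critical point
`c ∈ (0, K)`, `f'(0) > 1` (one-sided derivative), concave to the left of `c`, and with negative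
Schwarzian derivative away from `c`. -/
structure SingerMap (f : ℝ → ℝ) (K : ℝ) : Prop extends PopulationMap f K where
  differentiableOn : ∀ k < 3, DifferentiableOn ℝ (iteratedDeriv k f) (Ioi 0)
  differentiable_zero : DifferentiableWithinAt ℝ f (Ici 0) 0
  one_lt_deriv_zero : 1 < derivWithin f (Ici 0) 0
  unimodal : ∃ c ∈ Ioo 0 K,
    StrictMonoOn f (Icc 0 c) ∧ StrictAntiOn f (Ici c) ∧
    (∀ x > 0, deriv f x = 0 ↔ x = c) ∧
    (∀ x ∈ Ioo 0 c, iteratedDeriv 2 f x < 0) ∧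
    (∀ x > 0, x ≠ c → schwarzian f x < 0)

/-- The noise: i.i.d. random variables with values in `[-1, 1]` that charge every
left neighbourhood of `1`. Here `ξ n` stands for `ξ_{n+1}`, so the sequence is
`ξ_1, ξ_2, …`. -/
structure BoundedNoise {Ω : Type*} [MeasurableSpace Ω] (P : Measure Ω) (ξ : ℕ → Ω → ℝ) :
    Prop where
  measurable : ∀ n, Measurable (ξ n)
  indep : iIndepFun ξ P
  identDistrib : ∀ n, IdentDistrib (ξ n) (ξ 0) P P
  bounded : ∀ n, ∀ᵐ ω ∂P, |ξ n ω| ≤ 1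
  charges_one : ∀ ε > 0, ∀ n, 0 < P {ω | ξ n ω ∈ Ioc (1 - ε) 1}

/-- `x` solves `x_{n+1} = (1 - α - ℓ ξ_{n+1}) f(x_n) + (α + ℓ ξ_{n+1}) x_n` with the
nonrandom initial value `x₀` (recall that `ξ n` stands for `ξ_{n+1}`). -/
def IsPBCSolution {Ω : Type*} (f : ℝ → ℝ) (α ℓ : ℝ) (ξ : ℕ → Ω → ℝ) (x₀ : ℝ)
    (x : ℕ → Ω → ℝ) : Prop :=
  (∀ ω, x 0 ω = x₀) ∧
    ∀ n ω, x (n + 1) ω = (1 - α - ℓ * ξ n ω) * f (x n ω) + (α + ℓ * ξ n ω) * x n ω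

/-! Write `b = α + ℓ * ξ` for the random control intensity. The hypothesis `α + ℓ > α₀` says that
the largest intensity makes `K` linearly stable, and by negative Schwarzian derivative this local
stability is global. Indeed `|f'| ^ (-1/2)` is convex right of `c`, so comparing it with its tangent
at `K` squeezes `f` against a Möbius map (`exists_inv_sub_bound`), and no two points on opposite
sides of `K` can be exchanged or overshot (`SingerMap.no_overshoot`). A compactness argument then
gives a uniform number of steps after which intensities close to `α + ℓ` bring an invariant interval
near `K` (`exists_uniform_attraction`).

Near `K` an orbit contracts by roughly the random multiplier `|b + (1 - b) * deriv f K|`, whose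
logarithm is dominated by one with negative mean. By the strong law its partial sums tend to `-∞`,
so with positive probability they never exceed some constant `C`. A block of noise near `1` long
enough to enter the ball of radius `δ * exp (-C)`, followed by such a future, has positive
probability by independence, and by the zero-one law it occurs somewhere almost surely
(`BoundedNoise.exists_block`). From there the orbit never leaves the `δ`-ball, and it converges. -/

/-! ### Negative Schwarzian derivative and Möbius comparison. -/

/-- Where `f' < 0` and the Schwarzian derivative is negative, `|f'| ^ (-1/2)` is convex. -/
theorem convexOn_neg_deriv_rpow {f : ℝ → ℝ} {c : ℝ}
    (hdiff : ∀ k < 3, DifferentiableOn ℝ (iteratedDeriv k f) (Ioi c))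
    (hneg : ∀ x > c, deriv f x < 0) (hS : ∀ x > c, schwarzian f x < 0) :
    ConvexOn ℝ (Ioi c) (fun x => (-deriv f x) ^ (-1 / 2 : ℝ)) := by
  have h1 : ∀ x > c, HasDerivAt (deriv f) (iteratedDeriv 2 f x) x := fun x hx => by
    have := ((hdiff 1 (by norm_num)).differentiableAt (Ioi_mem_nhds hx)).hasDerivAt
    rwa [← iteratedDeriv_succ, iteratedDeriv_one] at this
  have h2 : ∀ x > c, HasDerivAt (iteratedDeriv 2 f) (iteratedDeriv 3 f x) x := fun x hx => by
    have := ((hdiff 2 (by norm_num)).differentiableAt (Ioi_mem_nhds hx)).hasDerivAt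
    rwa [← iteratedDeriv_succ] at this
  have hd : ∀ x > c, HasDerivAt (fun x => (-deriv f x) ^ (-1 / 2 : ℝ))
      (1 / 2 * iteratedDeriv 2 f x * (-deriv f x) ^ (-3 / 2 : ℝ)) x := fun x hx => by
    have := (h1 x hx).neg.rpow_const (p := -1 / 2) (Or.inl (by have := hneg x hx; simp; linarith))
    refine this.congr_deriv ?_
    rw [Pi.neg_apply, show (-1 / 2 - 1 : ℝ) = -3 / 2 by norm_num]
    ring
  have hdd : ∀ x > c, HasDerivAt
      (fun x => 1 / 2 * iteratedDeriv 2 f x * (-deriv f x) ^ (-3 / 2 : ℝ))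
      (-(1 / 2) * schwarzian f x * (-deriv f x) ^ (-1 / 2 : ℝ)) x := fun x hx => by
    have hpos : 0 < -deriv f x := by have := hneg x hx; linarith
    have := ((h2 x hx).const_mul (1 / 2)).mul
      ((h1 x hx).neg.rpow_const (p := -3 / 2) (Or.inl hpos.ne'))
    refine this.congr_deriv ?_
    -- All powers are reduced to the exponent `-5/2`, leaving a rational identity.
    have e1 : (-deriv f x) ^ (-1 / 2 : ℝ) = (-deriv f x) ^ (-5 / 2 : ℝ) * (-deriv f x) ^ 2 := by
      rw [← Real.rpow_natCast, ← Real.rpow_add hpos]; norm_num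
    have e2 : (-deriv f x) ^ (-3 / 2 : ℝ) = (-deriv f x) ^ (-5 / 2 : ℝ) * (-deriv f x) := by
      rw [← Real.rpow_add_one hpos.ne']; norm_num
    have e3 : (-3 / 2 - 1 : ℝ) = -5 / 2 := by norm_num
    have hne : deriv f x ≠ 0 := by linarith
    simp only [Pi.neg_apply]
    rw [e3, e1, e2, schwarzian]
    field_simp
    ring
  refine MonotoneOn.convexOn_of_deriv (convex_Ioi c)
    (fun x hx => (hd x hx).continuousAt.continuousWithinAt) ?_ ?_
  · rw [interior_Ioi]
    exact fun x hx => (hd x hx).differentiableAt.differentiableWithinAt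
  · rw [interior_Ioi]
    have hmono : MonotoneOn (fun x => 1 / 2 * iteratedDeriv 2 f x * (-deriv f x) ^ (-3 / 2 : ℝ))
        (Ioi c) := by
      refine monotoneOn_of_hasDerivWithinAt_nonneg (convex_Ioi c)
        (f' := fun x => -(1 / 2) * schwarzian f x * (-deriv f x) ^ (-1 / 2 : ℝ))
        (fun x hx => (hdd x hx).continuousAt.continuousWithinAt) ?_ ?_ <;> rw [interior_Ioi]
      · exact fun x hx => (hdd x hx).hasDerivWithinAt
      · intro x hx
        have := hS x hx
        have h3 := hneg x hx
        have : 0 ≤ (-deriv f x) ^ (-1 / 2 : ℝ) := Real.rpow_nonneg (by linarith) _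
        exact mul_nonneg (by linarith) this
    intro x hx y hy hxy
    rw [(hd x hx).deriv, (hd y hy).deriv]
    exact hmono hx hy hxy

/-- The graph of a decreasing map with negative Schwarzian derivative lies, near the point `K`,
below on the left and above on the right of a Möbius map osculating it at `K`. -/
theorem exists_inv_sub_bound {f : ℝ → ℝ} {c K : ℝ} (hcK : c < K)
    (hcont : ContinuousOn f (Ici c)) (hdiff : DifferentiableOn ℝ f (Ioi c))
    (hanti : StrictAntiOn f (Ici c)) (hneg : ∀ x > c, deriv f x < 0)
    (hconv : ConvexOn ℝ (Ioi c) (fun x => (-deriv f x) ^ (-1 / 2 : ℝ)))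
    (hdK : DifferentiableAt ℝ (deriv f) K) :
    ∃ m : ℝ, (∀ x ∈ Ico c K, (-deriv f K * (K - x))⁻¹ - m ≤ (f x - f K)⁻¹) ∧
      ∀ y > K, (-deriv f K * (y - K))⁻¹ + m ≤ (f K - f y)⁻¹ := by
  set h : ℝ → ℝ := fun x => (-deriv f x) ^ (-1 / 2 : ℝ) with hh
  have hpos : ∀ x > c, 0 < h x := fun x hx => Real.rpow_pos_of_pos (by linarith [hneg x hx]) _
  have hsq : ∀ x > c, (h x ^ 2)⁻¹ = -deriv f x := fun x hx => by
    have : 0 < -deriv f x := by linarith [hneg x hx]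
    rw [hh, ← Real.rpow_natCast, ← Real.rpow_mul this.le, ← Real.rpow_neg this.le]
    norm_num
  have hdh : DifferentiableAt ℝ h K :=
    hdK.neg.rpow_const (Or.inl (by have := hneg K hcK; simp; linarith))
  set m := deriv h K
  set l : ℝ → ℝ := fun t => h K + m * (t - K) with hl
  have htan : ∀ t > c, l t ≤ h t := fun t ht => by
    rcases lt_trichotomy t K with h1 | h1 | h1
    · have := hconv.slope_le_deriv ht hcK h1 hdh
      rw [slope_def_field, div_le_iff₀ (by linarith)] at this
      simp only [hl]; linarith
    · simp [hl, h1]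
    · have := hconv.deriv_le_slope hcK ht h1 hdh
      rw [slope_def_field, le_div_iff₀ (by linarith)] at this
      simp only [hl]; linarith
  have hK := hpos K hcK
  -- The Möbius map `(K - t) / (h K * l t)` has derivative `-1 / l ^ 2`, which is at most `-1 / h ^
  -- 2 = f'` because the tangent `l` lies below `h`.
  have hE : ∀ p q, c ≤ p → (∀ t ∈ Icc p q, 0 < l t) →
      AntitoneOn (fun t => (K - t) / (h K * l t) - f t) (Icc p q) := by
    intro p q hp hlp
    have hder : ∀ t ∈ Icc p q,
        HasDerivAt (fun t => (K - t) / (h K * l t)) (-(l t ^ 2)⁻¹) t := fun t ht => by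
      have hne := (hlp t ht).ne'
      have hl' : HasDerivAt l m t := by
        have := (((hasDerivAt_id t).sub_const K).const_mul m).const_add (h K)
        rwa [mul_one] at this
      have := ((hasDerivAt_id t).const_sub K).div (hl'.const_mul (h K)) (mul_ne_zero hK.ne' hne)
      refine this.congr_deriv ?_
      have hne' : h K + m * (t - K) ≠ 0 := hne
      simp only [hl, id]
      field_simp
      ring
    refine antitoneOn_of_hasDerivWithinAt_nonpos (convex_Icc p q)
      (f' := fun t => -(l t ^ 2)⁻¹ - deriv f t) ?_ ?_ ?_
    · exact ContinuousOn.sub (fun t ht => (hder t ht).continuousAt.continuousWithinAt)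
        (hcont.mono fun t ht => hp.trans ht.1)
    · intro t ht
      have ht' := interior_subset ht
      rw [interior_Icc] at ht
      exact ((hder t ht').sub (hdiff.differentiableAt
        (Ioi_mem_nhds (lt_of_le_of_lt hp ht.1))).hasDerivAt).hasDerivWithinAt
    · intro t ht
      have ht' := interior_subset ht
      rw [interior_Icc] at ht
      have htc : c < t := lt_of_le_of_lt hp ht.1
      have h1 := hsq t htc
      have h2 : (h t ^ 2)⁻¹ ≤ (l t ^ 2)⁻¹ := by
        have := hlp t ht'
        have := htan t htc
        gcongr
      linarith
  have hlK : l K = h K := by simp [hl]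
  refine ⟨m * h K, fun x hx => ?_, fun y hy => ?_⟩
  · have hu : 0 < K - x := by linarith [hx.2]
    have hfx : 0 < f x - f K := by linarith [hanti hx.1 hcK.le hx.2]
    have e : (-deriv f K * (K - x))⁻¹ - m * h K = h K * l x / (K - x) := by
      rw [← hsq K hcK]; simp only [hl]; field_simp; ring
    rw [e]
    -- If `l x ≤ 0` the left side is nonpositive; otherwise the affine `l` is positive on all of
    -- `[x, K]` and `hE` applies.
    rcases le_or_gt (l x) 0 with h0 | h0
    · exact (div_nonpos_of_nonpos_of_nonneg (mul_nonpos_of_nonneg_of_nonpos hK.le h0) hu.le).trans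
        (by positivity)
    · have := hE x K hx.1 (fun t ht => by
        rcases le_or_gt 0 m with hm | hm
        · have : m * (x - K) ≤ m * (t - K) := by gcongr; exact ht.1
          simp only [hl] at h0 ⊢; linarith
        · have : 0 ≤ m * (t - K) := mul_nonneg_of_nonpos_of_nonpos hm.le (by linarith [ht.2])
          simp only [hl]; linarith) (left_mem_Icc.2 hx.2.le) (right_mem_Icc.2 hx.2.le) hx.2.le
      simp only [sub_self, zero_div] at this
      rw [← inv_div]
      gcongr
      linarith
  · have hv : 0 < y - K := by linarith
    have hfy : 0 < f K - f y := by
      linarith [hanti (mem_Ici.2 hcK.le) (mem_Ici.2 (hcK.trans hy).le) hy]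
    have e : (-deriv f K * (y - K))⁻¹ + m * h K = h K * l y / (y - K) := by
      rw [← hsq K hcK]; simp only [hl]; field_simp
    rw [e]
    rcases le_or_gt (l y) 0 with h0 | h0
    · exact (div_nonpos_of_nonpos_of_nonneg (mul_nonpos_of_nonneg_of_nonpos hK.le h0) hv.le).trans
        (by positivity)
    · have := hE K y hcK.le (fun t ht => by
        rcases le_or_gt 0 m with hm | hm
        · have : 0 ≤ m * (t - K) := mul_nonneg hm (by linarith [ht.1])
          simp only [hl]; linarith
        · have : m * (y - K) ≤ m * (t - K) :=
            mul_le_mul_of_nonpos_left (by linarith [ht.2]) hm.le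
          simp only [hl] at h0 ⊢; linarith)
          (left_mem_Icc.2 (le_of_lt hy)) (right_mem_Icc.2 (le_of_lt hy)) (le_of_lt hy)
      simp only [sub_self, zero_div] at this
      have e2 : (K - y) / (h K * l y) = -((y - K) / (h K * l y)) := by ring
      rw [e2] at this
      rw [← inv_div]
      gcongr
      linarith

/-- The map controlled by an intensity `b` with `L (1 - b) < 1 + b`, `L = -f' K`, cannot
interchange, even weakly, the two sides of the equilibrium. -/
theorem SingerMap.no_overshoot {f : ℝ → ℝ} {K : ℝ} (hf : SingerMap f K) {b x y : ℝ}
    (hb0 : 0 < b) (hb1 : b < 1) (hb : -deriv f K * (1 - b) < 1 + b) (hx : x ∈ Ioo 0 K) (hy : K < y)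
    (hxy : y ≤ (1 - b) * f x + b * x) (hyx : (1 - b) * f y + b * y ≤ x) : False := by
  obtain ⟨c, ⟨hc0, hcK⟩, hmono, hanti, hcrit, -, hS⟩ := hf.unimodal
  have hd : ∀ k < 3, DifferentiableOn ℝ (iteratedDeriv k f) (Ioi c) := fun k hk =>
    (hf.differentiableOn k hk).mono (Ioi_subset_Ioi hc0.le)
  have hneg : ∀ t > c, deriv f t < 0 := fun t ht => by
    refine lt_of_le_of_ne ?_ fun h => ht.ne' ((hcrit t (hc0.trans ht)).1 h)
    have : derivWithin f (Ici c) t ≤ 0 := hanti.antitoneOn.derivWithin_nonpos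
    rwa [derivWithin_of_mem_nhds (Ici_mem_nhds ht)] at this
  obtain ⟨m, hm1, hm2⟩ := exists_inv_sub_bound hcK
    (hf.continuousOn.mono (Ici_subset_Ici.2 hc0.le)) (by simpa using hd 0 (by norm_num)) hanti hneg
    (convexOn_neg_deriv_rpow hd hneg fun t ht => hS t (hc0.trans ht) (ne_of_gt ht))
    (by simpa [iteratedDeriv_one] using
      (hd 1 (by norm_num)).differentiableAt (Ioi_mem_nhds hcK))
  have hL : 0 < -deriv f K := by linarith [hneg K hcK]
  set L := -deriv f K
  rw [hf.map_eq] at hm1 hm2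
  have hu : 0 < K - x := by linarith [hx.2]
  have hv : 0 < y - K := by linarith
  have hA : (y - K) + b * (K - x) ≤ (1 - b) * (f x - K) := by linarith
  have hB : (K - x) + b * (y - K) ≤ (1 - b) * (K - f y) := by linarith
  have hb' : 0 < 1 - b := by linarith
  have hfx : 0 < f x - K := pos_of_mul_pos_right (lt_of_lt_of_le (by positivity) hA) hb'.le
  have hfy : 0 < K - f y := pos_of_mul_pos_right (lt_of_lt_of_le (by positivity) hB) hb'.le
  -- Left of `c` the bound is inherited from `c`: moving from `c` to `x` lowers `f` and increases
  -- the distance to `K`.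
  have h1 : (L * (K - x))⁻¹ - m ≤ (f x - K)⁻¹ := by
    rcases le_or_gt c x with hcx | hcx
    · exact hm1 x ⟨hcx, hx.2⟩
    · have h3 := hm1 c ⟨le_rfl, hcK⟩
      have h4 : f x < f c := hmono ⟨hx.1.le, hcx.le⟩ ⟨hc0.le, le_rfl⟩ hcx
      have h5 : (f c - K)⁻¹ ≤ (f x - K)⁻¹ := by gcongr
      have h6 : (L * (K - x))⁻¹ ≤ (L * (K - c))⁻¹ := by
        have : 0 < K - c := by linarith
        gcongr
      linarith
  have h2 := hm2 y hy
  set u := K - x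
  set v := y - K
  have h3 : (f x - K)⁻¹ ≤ (1 - b) / (v + b * u) := by
    rw [inv_le_comm₀ hfx (by positivity), inv_div, div_le_iff₀ hb']; linarith
  have h4 : (K - f y)⁻¹ ≤ (1 - b) / (u + b * v) := by
    rw [inv_le_comm₀ hfy (by positivity), inv_div, div_le_iff₀ hb']; linarith
  -- The unknown constant `m` enters the two bounds with opposite signs and cancels in the sum.
  have h5 : (L * u)⁻¹ + (L * v)⁻¹ ≤ (1 - b) / (v + b * u) + (1 - b) / (u + b * v) := by linarith
  have e1 : (L * u)⁻¹ + (L * v)⁻¹ = (u + v) / (L * (u * v)) := by field_simp; ring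
  have e2 : (1 - b) / (v + b * u) + (1 - b) / (u + b * v) =
      (1 - b) * (1 + b) * (u + v) / ((v + b * u) * (u + b * v)) := by
    field_simp; ring
  have h6 : u * v * (1 + b) ^ 2 ≤ (v + b * u) * (u + b * v) := by
    nlinarith [mul_nonneg hb0.le (sq_nonneg (u - v))]
  have h7 : (1 - b) * (1 + b) * (u + v) / ((v + b * u) * (u + b * v)) ≤
      (1 - b) * (1 + b) * (u + v) / (u * v * (1 + b) ^ 2) := by gcongr
  have h8 : (u + v) / (L * (u * v)) ≤ (1 - b) * (1 + b) * (u + v) / (u * v * (1 + b) ^ 2) := by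
    linarith
  have e3 : (1 - b) * (1 + b) * (u + v) / (u * v * (1 + b) ^ 2) -
      (u + v) / (L * (u * v)) = (u + v) / (u * v) * ((L * (1 - b) - (1 + b)) / (L * (1 + b))) := by
    field_simp
  have h9 : (u + v) / (u * v) * ((L * (1 - b) - (1 + b)) / (L * (1 + b))) < 0 :=
    mul_neg_of_pos_of_neg (by positivity) (div_neg_of_neg_of_pos (by linarith) (by positivity))
  linarith

/-! ### Controlled maps: invariant intervals, global attraction, local contraction. -/

/-- The map `f` under prediction based control of intensity `b`. -/
def pbcMap (f : ℝ → ℝ) (b x : ℝ) : ℝ := (1 - b) * f x + b * x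

namespace PopulationMap

variable {f : ℝ → ℝ} {K : ℝ}

theorem lt_pbcMap (hf : PopulationMap f K) {b x : ℝ} (hb : b < 1) (hx : x ∈ Ioo 0 K) :
    x < pbcMap f b x := by
  have := mul_lt_mul_of_pos_left (hf.lt_map x hx) (sub_pos.2 hb)
  rw [pbcMap]; linarith

theorem pbcMap_lt (hf : PopulationMap f K) {b x : ℝ} (hb : b < 1) (hx : K < x) :
    pbcMap f b x < x := by
  have := mul_lt_mul_of_pos_left (hf.map_lt x hx) (sub_pos.2 hb)
  rw [pbcMap]; linarith

theorem pbcMap_self (hf : PopulationMap f K) (b : ℝ) : pbcMap f b K = K := by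
  rw [pbcMap, hf.map_eq]; ring

theorem pbcMap_le_of_le (hf : PopulationMap f K) {b b' x : ℝ} (hb : b ≤ b') (hx : x ∈ Ioo 0 K) :
    pbcMap f b' x ≤ pbcMap f b x := by
  have := mul_le_mul_of_nonneg_left (hf.lt_map x hx).le (sub_nonneg.2 hb)
  rw [pbcMap, pbcMap]; linarith

theorem le_pbcMap_of_le (hf : PopulationMap f K) {b b' x : ℝ} (hb : b ≤ b') (hx : K < x) :
    pbcMap f b x ≤ pbcMap f b' x := by
  have := mul_le_mul_of_nonneg_left (hf.map_lt x hx).le (sub_nonneg.2 hb)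
  rw [pbcMap, pbcMap]; linarith

end PopulationMap

namespace SingerMap

variable {f : ℝ → ℝ} {K : ℝ}

/-- Below `K` points move up, and above `K` the term `b * x` alone exceeds `β * K`; the upper end
works because it dominates both `x` and the maximum of `f`. -/
theorem exists_invariant_Icc (hf : SingerMap f K) {β x₀ : ℝ} (hβ : 0 < β) (hx₀ : 0 < x₀) :
    ∃ A B, 0 < A ∧ x₀ ∈ Icc A B ∧
      ∀ b, β ≤ b → b < 1 → ∀ x ∈ Icc A B, pbcMap f b x ∈ Icc A B := by
  obtain ⟨c, ⟨hc0, hcK⟩, hmono, hanti, -⟩ := hf.unimodal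
  have hmax : ∀ x ≥ 0, f x ≤ f c := fun x hx => by
    rcases le_total x c with h | h
    · exact hmono.monotoneOn ⟨hx, h⟩ ⟨hc0.le, le_rfl⟩ h
    · exact hanti.antitoneOn (mem_Ici.2 le_rfl) (mem_Ici.2 h) h
  have hK := hf.pos
  have hA : 0 < min x₀ (β * K) := lt_min hx₀ (by positivity)
  refine ⟨min x₀ (β * K), max x₀ (f c), hA, ⟨min_le_left _ _, le_max_left _ _⟩, ?_⟩
  intro b hb hb1 x hx
  have hx0 : 0 < x := hA.trans_le hx.1
  have hb0 : 0 < 1 - b := by linarith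
  constructor
  · rcases lt_trichotomy x K with h | h | h
    · exact hx.1.trans (hf.lt_pbcMap hb1 ⟨hx0, h⟩).le
    · rw [h, hf.pbcMap_self]; exact hx.1.trans h.le
    · have h1 : 0 ≤ (1 - b) * f x := mul_nonneg hb0.le (hf.map_pos x h).le
      have h2 : β * K ≤ b * x := mul_le_mul hb h.le hK.le (hβ.le.trans hb)
      rw [pbcMap]
      linarith [min_le_right x₀ (β * K)]
  · have h1 : (1 - b) * f x ≤ (1 - b) * max x₀ (f c) := by
      gcongr; exact (hmax x hx0.le).trans (le_max_right _ _)
    have h2 : b * x ≤ b * max x₀ (f c) := by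
      have : 0 ≤ b := by linarith
      gcongr; exact hx.2
    rw [pbcMap]; linarith

/-- Control intensities in a compact subinterval of the stabilizing range drive an invariant
interval to the equilibrium uniformly. -/
theorem exists_uniform_attraction (hf : SingerMap f K) {A B b₁ b₂ : ℝ} (hA : 0 < A)
    (hb0 : 0 < b₁) (hb2 : b₂ < 1) (hb : -deriv f K * (1 - b₁) < 1 + b₁)
    (hinv : ∀ b ∈ Icc b₁ b₂, ∀ x ∈ Icc A B, pbcMap f b x ∈ Icc A B) {ε : ℝ} (hε : 0 < ε) :
    ∃ N : ℕ, ∀ z : ℕ → ℝ, z 0 ∈ Icc A B →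
      (∀ i < N, ∃ b ∈ Icc b₁ b₂, z (i + 1) = pbcMap f b (z i)) → |z N - K| < ε := by
  let F : ℝ × ℝ → ℝ := fun p => pbcMap f p.1 p.2
  -- `C n` is the set of states reachable in `n` steps with intensities in `[b₁, b₂]`; the aim is
  -- that these sets shrink to `{K}`.
  let C : ℕ → Set ℝ := fun n => Nat.rec (Icc A B) (fun _ S => F '' (Icc b₁ b₂ ×ˢ S)) n
  have hC0 : C 0 = Icc A B := rfl
  have hCs : ∀ n, C (n + 1) = F '' (Icc b₁ b₂ ×ˢ C n) := fun n => rfl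
  have hanti : ∀ n, C (n + 1) ⊆ C n := by
    intro n
    induction n with
    | zero =>
      rw [hCs, hC0]
      rintro _ ⟨p, hp, rfl⟩
      exact hinv p.1 hp.1 p.2 hp.2
    | succ n ih =>
      rw [hCs (n + 1), hCs n]
      exact image_mono (prod_mono_right ih)
  have hmono : Antitone C := antitone_nat_of_succ_le hanti
  have hsub : ∀ n, C n ⊆ Icc A B := fun n => hmono (Nat.zero_le n)
  have hFc : ContinuousOn F (Icc b₁ b₂ ×ˢ Icc A B) := by
    have : ContinuousOn (fun p : ℝ × ℝ => f p.2) (Icc b₁ b₂ ×ˢ Icc A B) :=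
      hf.continuousOn.comp continuousOn_snd fun p hp => hA.le.trans hp.2.1
    exact ((continuousOn_const.sub continuousOn_fst).mul this).add
      (continuousOn_fst.mul continuousOn_snd)
  have hcomp : ∀ n, IsCompact (C n) := by
    intro n
    induction n with
    | zero => exact isCompact_Icc
    | succ n ih =>
      exact (isCompact_Icc.prod ih).image_of_continuousOn (hFc.mono (prod_mono_right (hsub n)))
  have hlim : ∀ y ∈ ⋂ n, C n, ∃ b ∈ Icc b₁ b₂, ∃ x ∈ ⋂ n, C n, pbcMap f b x = y := by
    intro y hy
    have hclosed : ∀ n, IsClosed ((Icc b₁ b₂ ×ˢ C n) ∩ F ⁻¹' {y}) := fun n =>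
      (hFc.mono (prod_mono_right (hsub n))).preimage_isClosed_of_isClosed
        (isClosed_Icc.prod (hcomp n).isClosed) isClosed_singleton
    obtain ⟨p, hp⟩ := IsCompact.nonempty_iInter_of_sequence_nonempty_isCompact_isClosed
      (fun n => (Icc b₁ b₂ ×ˢ C n) ∩ F ⁻¹' {y})
      (fun n => inter_subset_inter_left _ (prod_mono_right (hanti n)))
      (fun n => by
        obtain ⟨p, hp, hpy⟩ := (hCs n ▸ mem_iInter.1 hy (n + 1) : y ∈ F '' _)
        exact ⟨p, hp, hpy⟩)
      ((isCompact_Icc.prod (hcomp 0)).of_isClosed_subset (hclosed 0) inter_subset_left) hclosed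
    rw [mem_iInter] at hp
    exact ⟨p.1, (hp 0).1.1, p.2, mem_iInter.2 fun n => (hp n).1.2, (hp 0).2⟩
  have hsingle : ∀ y ∈ ⋂ n, C n, y = K := by
    intro y hy
    have hc : IsCompact (⋂ n, C n) := (hcomp 0).of_isClosed_subset
      (isClosed_iInter fun n => (hcomp n).isClosed) (iInter_subset _ 0)
    obtain ⟨p, hp, hpmin⟩ := hc.exists_isLeast ⟨y, hy⟩
    obtain ⟨q, hq, hqmax⟩ := hc.exists_isGreatest ⟨y, hy⟩
    have hpos : ∀ t ∈ ⋂ n, C n, 0 < t := fun t ht => hA.trans_le (mem_iInter.1 ht 0).1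
    obtain ⟨b, hbm, s, hs, hsp⟩ := hlim p hp
    obtain ⟨b', hbm', t, ht, htq⟩ := hlim q hq
    -- A predecessor `s < K` of the minimum `p` would satisfy `s < p`, against minimality; the
    -- maximum `q` is treated symmetrically.
    have hps : s < K ∨ p = K ∨ K < s := by
      rcases lt_trichotomy s K with h | h | h
      · exact Or.inl h
      · right; left; rw [← hsp, h, hf.pbcMap_self]
      · exact Or.inr (Or.inr h)
    have hp' : K ≤ p ∨ K < s := by
      rcases hps with h | h | h
      · have := hf.lt_pbcMap (hbm.2.trans_lt hb2) ⟨hpos s hs, h⟩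
        linarith [hpmin hs]
      · exact Or.inl h.ge
      · exact Or.inr h
    have hq' : q ≤ K ∨ t < K := by
      rcases lt_trichotomy t K with h | h | h
      · exact Or.inr h
      · left; rw [← htq, h, hf.pbcMap_self]
      · have := hf.pbcMap_lt (hbm'.2.trans_lt hb2) h
        linarith [hqmax ht]
    have hcase : (K ≤ p ∧ q ≤ K) ∨ (K < s ∧ t < K) := by
      rcases hp' with h | h <;> rcases hq' with h' | h'
      · exact Or.inl ⟨h, h'⟩
      · linarith [hpmin ht]
      · linarith [hqmax hs]
      · exact Or.inr ⟨h, h'⟩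
    rcases hcase with h | h
    · exact le_antisymm ((hqmax hy).trans h.2) (h.1.trans (hpmin hy))
    · exfalso
      have ht0 : t ∈ Ioo 0 K := ⟨hpos t ht, h.2⟩
      -- Lowering both intensities to the common value `b₁` only pushes the images further out, so
      -- `t` and `s` overshoot each other under `b₁`.
      refine hf.no_overshoot hb0 (hbm.1.trans_lt (hbm.2.trans_lt hb2)) hb ht0 h.1 ?_ ?_
      · have := hf.pbcMap_le_of_le hbm'.1 ht0
        rw [htq] at this
        exact (hqmax hs).trans this
      · have := hf.le_pbcMap_of_le hbm.1 h.1
        rw [hsp] at this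
        exact this.trans (hpmin ht)
  obtain ⟨N, hN⟩ := exists_subset_nhds_of_isCompact (V := C) (U := Metric.ball K ε)
    hmono.directed_ge hcomp fun y hy => by
      rw [hsingle y hy]; exact Metric.ball_mem_nhds K hε
  refine ⟨N, fun z hz0 hz => ?_⟩
  have hmem : ∀ n ≤ N, z n ∈ C n := by
    intro n
    induction n with
    | zero => exact fun _ => hz0
    | succ n ih =>
      intro hn
      obtain ⟨b, hbm, hbz⟩ := hz n hn
      rw [hCs, hbz]
      exact ⟨(b, z n), ⟨hbm, ih (Nat.le_of_succ_le hn)⟩, rfl⟩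
  simpa [Real.dist_eq] using hN (hmem N le_rfl)

theorem differentiableAt (hf : SingerMap f K) : DifferentiableAt ℝ f K := by
  simpa using (hf.differentiableOn 0 (by norm_num)).differentiableAt (Ioi_mem_nhds hf.pos)

/-- Near the equilibrium the controlled maps contract, up to `ε`, by their multiplier at `K`. -/
theorem exists_local_contraction (hf : SingerMap f K) {ε : ℝ} (hε : 0 < ε) :
    ∃ δ > 0, ∀ x, |x - K| < δ → ∀ b ∈ Icc (0 : ℝ) 1,
      |pbcMap f b x - K| ≤ (|b + (1 - b) * deriv f K| + ε) * |x - K| := by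
  have h := hf.differentiableAt.hasDerivAt.isLittleO.def hε
  obtain ⟨δ, hδ, hball⟩ := Metric.eventually_nhds_iff.1 h
  refine ⟨δ, hδ, fun x hx b hb => ?_⟩
  have h1 := hball (show dist x K < δ by rwa [Real.dist_eq])
  simp only [Real.norm_eq_abs, smul_eq_mul, hf.map_eq] at h1
  have e : pbcMap f b x - K = (b + (1 - b) * deriv f K) * (x - K) +
      (1 - b) * (f x - K - (x - K) * deriv f K) := by rw [pbcMap]; ring
  have h2 : |1 - b| ≤ 1 := abs_le.2 ⟨by linarith [hb.2], by linarith [hb.1]⟩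
  calc |pbcMap f b x - K| ≤ |b + (1 - b) * deriv f K| * |x - K| +
        |1 - b| * |f x - K - (x - K) * deriv f K| := by
        rw [e, ← abs_mul, ← abs_mul]; exact abs_add_le _ _
    _ ≤ |b + (1 - b) * deriv f K| * |x - K| + 1 * (ε * |x - K|) := by gcongr
    _ = _ := by ring

end SingerMap

/-! ### Recurrence and partial sums for i.i.d. noise. -/

/-- Used both for tail measurability in the zero-one law and for the independence of a block from
its future. -/
theorem measurable_shift_iSup_comap {Ω : Type*} {ξ : ℕ → Ω → ℝ} {S : Set ℕ} {k : ℕ}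
    (hk : ∀ i, k + i ∈ S) :
    Measurable[⨆ i ∈ S, MeasurableSpace.comap (ξ i) inferInstance]
      (fun ω i => ξ (k + i) ω) := by
  refine @measurable_pi_lambda _ _ _ (_) _ _ fun i => ?_
  have h : MeasurableSpace.comap (ξ (k + i)) inferInstance ≤
      ⨆ i ∈ S, MeasurableSpace.comap (ξ i) inferInstance :=
    le_iSup₂ (f := fun j (_ : j ∈ S) => MeasurableSpace.comap (ξ j) inferInstance) (k + i) (hk i)
  exact (comap_measurable (ξ (k + i))).mono h le_rfl

section Noise

variable {Ω : Type*} [MeasurableSpace Ω] {P : Measure Ω} {ξ : ℕ → Ω → ℝ}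

/-- An event of positive probability about an i.i.d. sequence almost surely occurs for infinitely
many of its shifts. -/
theorem ae_frequently_shift_mem [IsProbabilityMeasure P] (hm : ∀ n, Measurable (ξ n))
    (hind : iIndepFun ξ P)
    (hid : ∀ n, IdentDistrib (ξ n) (ξ 0) P P) {A : Set (ℕ → ℝ)} (hA : MeasurableSet A)
    (hpos : P {ω | (fun i => ξ i ω) ∈ A} ≠ 0) :
    ∀ᵐ ω ∂P, ∃ᶠ k in atTop, (fun i => ξ (k + i) ω) ∈ A := by
  let E : ℕ → Set Ω := fun k => (fun ω i => ξ (k + i) ω) ⁻¹' A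
  let s : ℕ → MeasurableSpace Ω := fun i => MeasurableSpace.comap (ξ i) inferInstance
  have hT : ∀ n, {ω | ∃ᶠ k in atTop, (fun i => ξ (k + i) ω) ∈ A} = ⋂ j, ⋃ k, E (n + j + k) := by
    intro n
    ext ω
    simp only [mem_ofPred_eq, frequently_atTop, mem_iInter, mem_iUnion]
    constructor
    · intro h j
      obtain ⟨b, hb, hbA⟩ := h (n + j)
      refine ⟨b - (n + j), ?_⟩
      rwa [Nat.add_sub_cancel' hb]
    · intro h a
      obtain ⟨k, hk⟩ := h a
      exact ⟨n + a + k, by omega, hk⟩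
  have hEm : ∀ k, MeasurableSet (E k) := fun k =>
    (measurable_pi_lambda _ fun i => hm (k + i)) hA
  have hPE : ∀ k, P (E k) = P {ω | (fun i => ξ i ω) ∈ A} := fun k =>
    (IdentDistrib.pi (X := fun i => ξ (k + i)) (Y := ξ)
      (fun i => (hid (k + i)).trans (hid i).symm)
      (hind.precomp (add_right_injective k)) hind).measure_mem_eq hA
  have htail : MeasurableSet[limsup s atTop]
      {ω | ∃ᶠ k in atTop, (fun i => ξ (k + i) ω) ∈ A} := by
    rw [limsup_eq_iInf_iSup_of_nat, MeasurableSpace.measurableSet_iInf]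
    intro n
    rw [hT n]
    refine MeasurableSet.iInter fun j => MeasurableSet.iUnion fun k => ?_
    exact measurable_shift_iSup_comap (S := {i | i ≥ n}) (fun i => by simp; omega) hA
  -- The event is a decreasing intersection of unions, each containing a shifted copy of the
  -- original event, of the same probability.
  have hlow : P {ω | (fun i => ξ i ω) ∈ A} ≤
      P {ω | ∃ᶠ k in atTop, (fun i => ξ (k + i) ω) ∈ A} := by
    rw [hT 0, Antitone.measure_iInter]
    · refine le_iInf fun j => ?_
      rw [← hPE (0 + j + 0)]
      exact measure_mono (subset_iUnion (fun k => E (0 + j + k)) 0)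
    · intro j j' hj
      refine iUnion_subset fun k => ?_
      have e : 0 + j' + k = 0 + j + (j' - j + k) := by omega
      rw [e]
      exact subset_iUnion (fun k => E (0 + j + k)) _
    · exact fun j => (MeasurableSet.iUnion fun k => hEm _).nullMeasurableSet
    · exact ⟨0, measure_ne_top _ _⟩
  have hmT : MeasurableSet {ω | ∃ᶠ k in atTop, (fun i => ξ (k + i) ω) ∈ A} := by
    rw [hT 0]
    exact MeasurableSet.iInter fun j => MeasurableSet.iUnion fun k => hEm _
  rcases measure_zero_or_one_of_measurableSet_limsup_atTop (s := s)
    (fun n => (hm n).comap_le) hind htail with h | h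
  · rw [h] at hlow
    exact absurd (le_antisymm hlow zero_le) hpos
  · exact (prob_compl_eq_zero_iff hmT).2 h

theorem ae_tendsto_sum_atBot [IsProbabilityMeasure P] (hind : iIndepFun ξ P)
    (hid : ∀ n, IdentDistrib (ξ n) (ξ 0) P P) {g : ℝ → ℝ} (hg : Measurable g)
    (hInt : Integrable (fun ω => g (ξ 0 ω)) P) (hneg : ∫ ω, g (ξ 0 ω) ∂P < 0) :
    ∀ᵐ ω ∂P, Tendsto (fun n => ∑ i ∈ Finset.range n, g (ξ i ω)) atTop atBot := by
  have h := strong_law_ae_real (μ := P) (fun n ω => g (ξ n ω)) hInt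
    (fun i j hij => (hind.indepFun hij).comp hg hg) (fun i => (hid i).comp hg)
  filter_upwards [h] with ω hω
  have := hω.neg_mul_atTop hneg tendsto_natCast_atTop_atTop
  refine this.congr' ?_
  filter_upwards [eventually_gt_atTop 0] with n hn
  have : (n : ℝ) ≠ 0 := by positivity
  field_simp

/-- A block of `N` noise values near `1`, followed by a sequence along which the partial sums of
`g` stay below a constant not depending on the block, almost surely occurs. -/
theorem BoundedNoise.exists_block [IsProbabilityMeasure P] (hξ : BoundedNoise P ξ) {g : ℝ → ℝ}
    (hg : Measurable g) (hInt : Integrable (fun ω => g (ξ 0 ω)) P)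
    (hneg : ∫ ω, g (ξ 0 ω) ∂P < 0) :
    ∃ C : ℝ, ∀ N : ℕ, ∀ η > 0, ∀ᵐ ω ∂P, ∃ k, (∀ i < N, ξ (k + i) ω ∈ Ioc (1 - η) 1) ∧
      ∀ n, ∑ i ∈ Finset.range n, g (ξ (k + N + i) ω) ≤ C := by
  let D : ℕ → Set (ℕ → ℝ) := fun C => {z | ∀ n, ∑ i ∈ Finset.range n, g (z i) ≤ C}
  have hD : ∀ C, MeasurableSet (D C) := fun C => by
    have : D C = ⋂ n, {z : ℕ → ℝ | ∑ i ∈ Finset.range n, g (z i) ≤ C} := by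
      ext z; simp [D]
    rw [this]
    exact MeasurableSet.iInter fun n => measurableSet_le
      (Finset.measurable_sum _ fun i _ => hg.comp (measurable_pi_apply i)) measurable_const
  obtain ⟨C, hC⟩ : ∃ C, P {ω | (fun i => ξ i ω) ∈ D C} ≠ 0 := by
    -- Sums tending to `-∞` are bounded above, so the countably many events for natural `C` cannot
    -- all be null.
    by_contra! h
    have h1 : ∀ᵐ ω ∂P, ∀ C, (fun i => ξ i ω) ∉ D C := ae_all_iff.2 fun C => by
      rw [ae_iff]; simpa using h C
    obtain ⟨ω, hω1, hω2⟩ :=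
      (h1.and (ae_tendsto_sum_atBot hξ.indep hξ.identDistrib hg hInt hneg)).exists
    obtain ⟨M, hM⟩ := (hω2.isBoundedUnder_le_atBot).bddAbove_range
    obtain ⟨C, hC⟩ := exists_nat_ge M
    exact hω1 C fun n => (hM (mem_range_self n)).trans hC
  refine ⟨C, fun N η hη => ?_⟩
  let A : Set (ℕ → ℝ) := {z | (∀ i < N, z i ∈ Ioc (1 - η) 1) ∧ (fun i => z (N + i)) ∈ D C}
  have hA1 : MeasurableSet {z : ℕ → ℝ | ∀ i < N, z i ∈ Ioc (1 - η) 1} := by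
    have : {z : ℕ → ℝ | ∀ i < N, z i ∈ Ioc (1 - η) 1} =
        ⋂ i, ⋂ (_ : i < N), (fun z : ℕ → ℝ => z i) ⁻¹' Ioc (1 - η) 1 := by
      ext z; simp
    rw [this]
    exact MeasurableSet.iInter fun i => MeasurableSet.iInter fun _ =>
      measurable_pi_apply i measurableSet_Ioc
  have hshift : Measurable fun (z : ℕ → ℝ) i => z (N + i) :=
    measurable_pi_lambda _ fun i => measurable_pi_apply (N + i)
  have hA : MeasurableSet A := hA1.inter (hshift (hD C))
  have hpos : P {ω | (fun i => ξ i ω) ∈ A} ≠ 0 := by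
    have hindep := indep_iSup_of_disjoint (fun n => (hξ.measurable n).comap_le) hξ.indep
      (S := Iio N) (T := Ici N) (by
        rw [Set.disjoint_left]; intro i hi hi'; exact (mem_Iio.1 hi).not_ge hi')
    have h1 : MeasurableSet[⨆ i ∈ Iio N, MeasurableSpace.comap (ξ i) inferInstance]
        (⋂ i ∈ Finset.range N, ξ i ⁻¹' Ioc (1 - η) 1) := by
      refine Finset.measurableSet_biInter _ fun i hi => ?_
      have h : MeasurableSpace.comap (ξ i) inferInstance ≤
          ⨆ i ∈ Iio N, MeasurableSpace.comap (ξ i) inferInstance :=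
        le_iSup₂ (f := fun j (_ : j ∈ Iio N) => MeasurableSpace.comap (ξ j) inferInstance) i
          (Finset.mem_range.1 hi)
      exact h _ ⟨_, measurableSet_Ioc, rfl⟩
    have h2 : MeasurableSet[⨆ i ∈ Ici N, MeasurableSpace.comap (ξ i) inferInstance]
        ((fun ω i => ξ (N + i) ω) ⁻¹' D C) :=
      measurable_shift_iSup_comap (fun i => mem_Ici.2 (Nat.le_add_right N i)) (hD C)
    have e : {ω | (fun i => ξ i ω) ∈ A} =
        (⋂ i ∈ Finset.range N, ξ i ⁻¹' Ioc (1 - η) 1) ∩ (fun ω i => ξ (N + i) ω) ⁻¹' D C := by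
      ext ω; simp [A]
    rw [e, (Indep_iff _ _ _).1 hindep _ _ h1 h2,
      hξ.indep.measure_inter_preimage_eq_mul _ fun i _ => measurableSet_Ioc]
    refine mul_ne_zero (Finset.prod_ne_zero_iff.2 fun i _ => (hξ.charges_one η hη i).ne') ?_
    have : P ((fun ω i => ξ (N + i) ω) ⁻¹' D C) = P {ω | (fun i => ξ i ω) ∈ D C} :=
      (IdentDistrib.pi (X := fun i => ξ (N + i)) (Y := ξ)
        (fun i => (hξ.identDistrib (N + i)).trans (hξ.identDistrib i).symm)
        (hξ.indep.precomp (add_right_injective N)) hξ.indep).measure_mem_eq (hD C)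
    rwa [this]
  filter_upwards [ae_frequently_shift_mem hξ.measurable hξ.indep hξ.identDistrib hA hpos]
    with ω hω
  obtain ⟨k, hk⟩ := hω.exists
  refine ⟨k, hk.1, fun n => ?_⟩
  simpa only [add_assoc] using hk.2 n

end Noise

/-- If the logarithm of a positive continuous function of the noise has negative mean, this
persists after adding a small constant to the function. -/
theorem BoundedNoise.exists_integral_log_add_neg {Ω : Type*} [MeasurableSpace Ω] {P : Measure Ω}
    [IsProbabilityMeasure P] {ξ : ℕ → Ω → ℝ} (hξ : BoundedNoise P ξ) {m : ℝ → ℝ}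
    (hm : Continuous m) (hpos : ∀ t ∈ Icc (-1 : ℝ) 1, 0 < m t)
    (hneg : ∫ ω, Real.log (m (ξ 0 ω)) ∂P < 0) :
    ∃ ε > 0, Integrable (fun ω => Real.log (m (ξ 0 ω) + ε)) P ∧
      ∫ ω, Real.log (m (ξ 0 ω) + ε) ∂P < 0 := by
  obtain ⟨t₀, ht₀, hmin⟩ := (isCompact_Icc (a := (-1 : ℝ)) (b := 1)).exists_isMinOn
    ⟨0, by norm_num⟩ hm.continuousOn
  have hm0 := hpos t₀ ht₀
  have hInt : ∀ ε ≥ 0, Integrable (fun ω => Real.log (m (ξ 0 ω) + ε)) P := fun ε hε => by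
    have hc : ContinuousOn (fun t => Real.log (m t + ε)) (Icc (-1) 1) :=
      (hm.add continuous_const).continuousOn.log fun t ht =>
        (by have := hpos t ht; simp only [Pi.add_apply]; positivity)
    obtain ⟨M, hM⟩ := isCompact_Icc.exists_bound_of_continuousOn hc
    refine Integrable.of_bound (Real.measurable_log.comp
      ((hm.measurable.comp (hξ.measurable 0)).add_const ε)).aestronglyMeasurable M ?_
    filter_upwards [hξ.bounded 0] with ω hω using hM _ (abs_le.1 hω)
  set I := ∫ ω, Real.log (m (ξ 0 ω)) ∂P
  -- Since `m t₀` is the minimum of `m`, this shift multiplies `m` by at most `1 - I / 2`, raising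
  -- the mean logarithm by at most `-I / 2`.
  refine ⟨m t₀ * (-I / 2), by have : 0 < -I / 2 := (by linarith); positivity, ?_, ?_⟩
  · exact hInt _ (mul_nonneg hm0.le (by linarith))
  · have hI0 : Integrable (fun ω => Real.log (m (ξ 0 ω))) P := by simpa using hInt 0 le_rfl
    have hle : ∫ ω, Real.log (m (ξ 0 ω) + m t₀ * (-I / 2)) ∂P ≤
        ∫ ω, (Real.log (m (ξ 0 ω)) + -I / 2) ∂P := by
      refine integral_mono_ae (hInt _ (mul_nonneg hm0.le (by linarith)))
        (hI0.add (integrable_const _)) ?_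
      filter_upwards [hξ.bounded 0] with ω hω
      have h1 := hpos _ (abs_le.1 hω)
      have h2 : m t₀ ≤ m (ξ 0 ω) := hmin (abs_le.1 hω)
      have h3 : 0 ≤ -I / 2 := by linarith
      have h4 : m (ξ 0 ω) + m t₀ * (-I / 2) ≤ m (ξ 0 ω) * (1 + -I / 2) := by nlinarith
      calc Real.log (m (ξ 0 ω) + m t₀ * (-I / 2))
          ≤ Real.log (m (ξ 0 ω) * (1 + -I / 2)) := Real.log_le_log (by positivity) h4
        _ = Real.log (m (ξ 0 ω)) + Real.log (1 + -I / 2) :=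
            Real.log_mul h1.ne' (by positivity)
        _ ≤ Real.log (m (ξ 0 ω)) + -I / 2 := by
            have := Real.log_le_sub_one_of_pos (show 0 < 1 + -I / 2 by positivity)
            linarith
    rw [integral_add hI0 (integrable_const _), integral_const] at hle
    simp only [probReal_univ, one_smul] at hle
    linarith

/-! ### Almost sure convergence. -/

/-- Stabilization by noise when the multiplier at the equilibrium is dominated by a positive
function of the noise whose logarithm has negative mean. -/
theorem SingerMap.ae_tendsto_of_integral_log_neg {Ω : Type*} [MeasurableSpace Ω] {P : Measure Ω}
    [IsProbabilityMeasure P] {ξ : ℕ → Ω → ℝ} (hξ : BoundedNoise P ξ)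
    {f : ℝ → ℝ} {K : ℝ} (hf : SingerMap f K) {α ℓ : ℝ} (hℓ : 0 < ℓ) (hαℓ : ℓ < α)
    (hαℓ1 : α + ℓ < 1) (hstab : -deriv f K * (1 - (α + ℓ)) < 1 + (α + ℓ)) {m : ℝ → ℝ}
    (hm : Continuous m) (hpos : ∀ t ∈ Icc (-1 : ℝ) 1, 0 < m t)
    (hdom : ∀ t ∈ Icc (-1 : ℝ) 1, |α + ℓ * t + (1 - (α + ℓ * t)) * deriv f K| ≤ m t)
    (hneg : ∫ ω, Real.log (m (ξ 0 ω)) ∂P < 0)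
    {x₀ : ℝ} (hx₀ : 0 < x₀) {x : ℕ → Ω → ℝ} (hx : IsPBCSolution f α ℓ ξ x₀ x) :
    ∀ᵐ ω ∂P, Tendsto (fun n => x n ω) atTop (𝓝 K) := by
  obtain ⟨ε, hε, hInt, hneg'⟩ := hξ.exists_integral_log_add_neg hm hpos hneg
  have hgm : Measurable fun t => Real.log (m t + ε) :=
    Real.measurable_log.comp (hm.measurable.add_const ε)
  obtain ⟨C, hC⟩ := hξ.exists_block hgm hInt hneg'
  obtain ⟨δ, hδ, hloc⟩ := hf.exists_local_contraction hε
  obtain ⟨b₁, hb₁, hb₁'⟩ : ∃ b₁ ∈ Ioo (α - ℓ) (α + ℓ), -deriv f K * (1 - b₁) < 1 + b₁ := by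
    have hcont : Continuous fun b : ℝ => 1 + b - -deriv f K * (1 - b) := by fun_prop
    have h := (hcont.tendsto (α + ℓ)).eventually (lt_mem_nhds (a := 0) (by linarith))
    obtain ⟨b, hb, hb'⟩ := ((h.filter_mono nhdsWithin_le_nhds).and
      (Ioo_mem_nhdsLT (by linarith : α - ℓ < α + ℓ))).exists
    exact ⟨b, hb', by linarith⟩
  obtain ⟨A, B, hA, hx₀AB, hinv⟩ := hf.exists_invariant_Icc (sub_pos.2 hαℓ) hx₀
  obtain ⟨N, hN⟩ := hf.exists_uniform_attraction (A := A) (B := B) (b₂ := α + ℓ) hA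
    (by linarith [hb₁.1]) hαℓ1 hb₁'
    (fun b hb => hinv b (hb₁.1.le.trans hb.1) (hb.2.trans_lt hαℓ1))
    (mul_pos hδ (Real.exp_pos (-C)))
  -- With this margin, noise above `1 - η` means intensity above `b₁`.
  have hη : 0 < (α + ℓ - b₁) / ℓ := div_pos (by linarith [hb₁.2]) hℓ
  filter_upwards [ae_all_iff.2 hξ.bounded, hC N _ hη,
    ae_tendsto_sum_atBot hξ.indep hξ.identDistrib hgm hInt hneg'] with ω hω hk hsum
  have hstep : ∀ n, x (n + 1) ω = pbcMap f (α + ℓ * ξ n ω) (x n ω) := fun n => by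
    rw [hx.2 n ω, pbcMap]; ring
  have hbd : ∀ n, α - ℓ ≤ α + ℓ * ξ n ω ∧ α + ℓ * ξ n ω ≤ α + ℓ := fun n => by
    have := abs_le.1 (hω n)
    constructor <;> nlinarith
  have hmem : ∀ n, x n ω ∈ Icc A B := by
    intro n
    induction n with
    | zero => rw [hx.1]; exact hx₀AB
    | succ n ih =>
      rw [hstep]
      exact hinv _ (hbd n).1 ((hbd n).2.trans_lt hαℓ1) _ ih
  obtain ⟨k, hblock, hC'⟩ := hk
  have hnear : |x (k + N) ω - K| < δ * Real.exp (-C) :=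
    hN (fun i => x (k + i) ω) (hmem _) fun i hi =>
      ⟨α + ℓ * ξ (k + i) ω, ⟨by
        have := (hblock i hi).1
        have h2 : ℓ * (1 - (α + ℓ - b₁) / ℓ) < ℓ * ξ (k + i) ω := by gcongr
        have e : ℓ * (1 - (α + ℓ - b₁) / ℓ) = b₁ - α := by field_simp; ring
        linarith, (hbd _).2⟩, hstep (k + i)⟩
  have hdecay : ∀ n, |x (k + N + n) ω - K| ≤
      Real.exp (∑ i ∈ Finset.range n, Real.log (m (ξ (k + N + i) ω) + ε)) *
        |x (k + N) ω - K| := by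
    intro n
    induction n with
    | zero => simp
    | succ n ih =>
      -- The factor `exp (-C)` in the entry radius absorbs the largest possible growth `exp C`, so
      -- the local estimate stays available.
      have hlt : |x (k + N + n) ω - K| < δ := by
        refine ih.trans_lt ?_
        calc _ ≤ Real.exp C * |x (k + N) ω - K| := by gcongr; exact hC' n
          _ < Real.exp C * (δ * Real.exp (-C)) := by gcongr
          _ = δ := by rw [Real.exp_neg]; field_simp
      have hξ1 : ξ (k + N + n) ω ∈ Icc (-1 : ℝ) 1 := abs_le.1 (hω _)
      have h1 := hloc _ hlt (α + ℓ * ξ (k + N + n) ω)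
        ⟨by linarith [(hbd (k + N + n)).1], by linarith [(hbd (k + N + n)).2]⟩
      rw [Finset.sum_range_succ, Real.exp_add,
        Real.exp_log (by have := hpos _ hξ1; positivity), ← add_assoc, hstep]
      calc _ ≤ _ := h1
        _ ≤ (m (ξ (k + N + n) ω) + ε) * |x (k + N + n) ω - K| := by
            gcongr; exact hdom _ hξ1
        _ ≤ (m (ξ (k + N + n) ω) + ε) * (_ * |x (k + N) ω - K|) := by
            have := hpos _ hξ1
            gcongr
        _ = _ := by ring
  have hsum' : Tendsto (fun n => ∑ i ∈ Finset.range n, Real.log (m (ξ (k + N + i) ω) + ε))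
      atTop atBot := by
    have h1 := tendsto_atBot_add_const_right atTop
      (-∑ i ∈ Finset.range (k + N), Real.log (m (ξ i ω) + ε))
      (hsum.comp (tendsto_add_atTop_nat (k + N)))
    refine h1.congr fun n => ?_
    simp only [Function.comp]
    rw [add_comm n, Finset.sum_range_add]
    ring
  have hlim : Tendsto (fun n => |x (k + N + n) ω - K|) atTop (𝓝 0) :=
    squeeze_zero (fun _ => abs_nonneg _) hdecay (by
      simpa using (Real.tendsto_exp_atBot.comp hsum').mul_const (|x (k + N) ω - K|))
  rw [← tendsto_add_atTop_iff_nat (k + N), tendsto_iff_norm_sub_tendsto_zero]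
  simpa only [Real.norm_eq_abs, add_comm _ (k + N)] using hlim

theorem mainTheorem2 {Ω : Type*} [MeasurableSpace Ω] (P : Measure Ω) [IsProbabilityMeasure P]
    (ξ : ℕ → Ω → ℝ) (hξ : BoundedNoise P ξ)
    (f : ℝ → ℝ) (K : ℝ) (hf : SingerMap f K)
    (L₀ α₀ : ℝ) (hL₀ : L₀ = -deriv f K) (hα₀ : α₀ = (L₀ - 1) / (L₀ + 1))
    (α ℓ : ℝ) (hα : α ∈ Ioo 0 α₀) (hℓ : ℓ ∈ Ioo (α₀ - α) (min α (1 - α)))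
    (hcond :
      (α + ℓ < L₀ / (L₀ + 1) ∧
        ∫ ω, Real.log ((1 - α - ℓ * ξ 0 ω) * L₀ - α - ℓ * ξ 0 ω) ∂P < 0) ∨
      ∫ ω, max (Real.log ((1 - α - ℓ * ξ 0 ω) * L₀)) (Real.log (α + ℓ * ξ 0 ω)) ∂P < 0)
    (x₀ : ℝ) (hx₀ : 0 < x₀) (x : ℕ → Ω → ℝ) (hx : IsPBCSolution f α ℓ ξ x₀ x) :
    ∀ᵐ ω ∂P, Tendsto (fun n => x n ω) atTop (𝓝 K) := by
  have hL0 : 0 < L₀ := by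
    obtain ⟨c, ⟨hc0, hcK⟩, -, hanti, hcrit, -⟩ := hf.unimodal
    have h1 : derivWithin f (Ici c) K ≤ 0 := hanti.antitoneOn.derivWithin_nonpos
    rw [derivWithin_of_mem_nhds (Ici_mem_nhds hcK)] at h1
    have h2 : deriv f K ≠ 0 := fun h => hcK.ne' ((hcrit K hf.pos).1 h)
    rw [hL₀]
    linarith [lt_of_le_of_ne h1 h2]
  have hd : deriv f K = -L₀ := by linarith
  have hℓα : ℓ < α := hℓ.2.trans_le (min_le_left _ _)
  have hℓ1 : ℓ < 1 - α := hℓ.2.trans_le (min_le_right _ _)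
  have hℓ0 : 0 < ℓ := by linarith [hℓ.1, hα.2]
  have hstab : -deriv f K * (1 - (α + ℓ)) < 1 + (α + ℓ) := by
    have h : (L₀ - 1) / (L₀ + 1) < α + ℓ := by linarith [hℓ.1]
    rw [div_lt_iff₀ (by linarith)] at h
    rw [← hL₀]
    linarith
  have hb : ∀ t ∈ Icc (-1 : ℝ) 1, 0 < α + ℓ * t ∧ α + ℓ * t ≤ α + ℓ := fun t ht => by
    constructor <;> nlinarith [ht.1, ht.2]
  -- The multiplier is `b - (1 - b) * L₀`. In the first case it is negative for every noise value,
  -- so its modulus is explicit; in the second, the modulus of a difference of positive numbers is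
  -- at most their maximum.
  rcases hcond with ⟨hlt, hInt⟩ | hInt
  · rw [lt_div_iff₀ (by linarith)] at hlt
    have hpos : ∀ t ∈ Icc (-1 : ℝ) 1, 0 < (1 - α - ℓ * t) * L₀ - α - ℓ * t := fun t ht => by
      nlinarith [hb t ht]
    refine hf.ae_tendsto_of_integral_log_neg hξ hℓ0 hℓα (by linarith) hstab
      (m := fun t => (1 - α - ℓ * t) * L₀ - α - ℓ * t) (by fun_prop) hpos (fun t ht => ?_) hInt
      hx₀ hx
    rw [hd, ← abs_neg, abs_of_pos (by linarith [hpos t ht])]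
    exact le_of_eq (by ring)
  · have hpos1 : ∀ t ∈ Icc (-1 : ℝ) 1, 0 < (1 - α - ℓ * t) * L₀ := fun t ht =>
      mul_pos (by linarith [hb t ht]) hL0
    refine hf.ae_tendsto_of_integral_log_neg hξ hℓ0 hℓα (by linarith) hstab
      (m := fun t => max ((1 - α - ℓ * t) * L₀) (α + ℓ * t)) (by fun_prop)
      (fun t ht => lt_max_of_lt_right (hb t ht).1) (fun t ht => ?_) ?_ hx₀ hx
    · have h1 := (hb t ht).1
      have h2 := hpos1 t ht
      rw [hd, abs_le]
      constructor
      · linarith [le_max_left ((1 - α - ℓ * t) * L₀) (α + ℓ * t)]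
      · linarith [le_max_right ((1 - α - ℓ * t) * L₀) (α + ℓ * t)]
    · refine lt_of_eq_of_lt (integral_congr_ae ?_) hInt
      filter_upwards [hξ.bounded 0] with ω hω
      have hω' : ξ 0 ω ∈ Icc (-1 : ℝ) 1 := abs_le.1 hω
      have h1 := (hb _ hω').1
      have h2 := hpos1 _ hω'
      rcases le_total ((1 - α - ℓ * ξ 0 ω) * L₀) (α + ℓ * ξ 0 ω) with h | h
      · rw [max_eq_right h, max_eq_right (Real.log_le_log h2 h)]
      · rw [max_eq_left h, max_eq_left (Real.log_le_log h1 h)]
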